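/- Let $F$ be a finite extension of $\mathbb{Q}_p$ for some prime $p$, and let $K/F$ be a quadratic extension that is wildly ramified, i.e. $K/F$ is ramified and $p=2$. For a local field $L$ let $v_L$ be its normalized valuation, $O_L$ its ring of integers and $P_L$ the maximal ideal; put $U_L^0=O_L^\times$ and $U_L^n=1+P_L^n$ for $n\ge 1$. The conductor $a(\chi)$ of a continuous character $\chi:L^\times\to\mathbb{C}^\times$ is the smallest integer $n\ge 0$ such that $\chi$ is trivial on $U_L^n$. Let $\omega_{K/F}$ be the quadratic character of $F^\times$ associated to $K/F$ by class field theory, i.e. the unique nontrivial character of $F^\times/N_{K/F}(K^\times)$. Let $t$ be the ramification break of $K/F$, i.e. the integer $t\ge -1$ with $G_t\neq G_{t+1}$, where $G_i=\{\sigma\in \mathrm{Gal}(K/F) : v_K(\sigma(\alpha)-\alpha)\ge i+1 \text{ for all } \alpha\in O_K\}$. Then $a(\omega_{K/F})=t+1$. Moreover, let $\chi:K^\times\to\mathbb{C}^\times$ be any continuous character of symplectic type, i.e. with $\chi|_{F^\times}=\omega_{K/F}$, and let $m=a(\chi)$. If $m$ is odd, then $m=2t+1$; if $m$ is even, then $m\ge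 2(t+1)$. -/

import Mathlib

open ValuativeRel
open scoped WithZero

namespace WildQuadratic

noncomputable section

/-- The normalized valuation of a local field, written multiplicatively: it takes values in
`ℤᵐ⁰`, and `v_L(x) = i` corresponds to the value `WithZero.exp (-i)`. It is surjective because
it is the canonical valuation followed by an order isomorphism onto `ℤᵐ⁰`. -/
def normVal (L : Type*) [Field L] [ValuativeRel L] [TopologicalSpace L]
    [IsNonarchimedeanLocalField L] : Valuation L ℤᵐ⁰ :=
  (valuation L).map
    { toFun := IsNonarchimedeanLocalField.valueGroupWithZeroIsoInt L
      map_zero' := map_zero _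
      map_one' := map_one _
      map_mul' := map_mul _ }
    (IsNonarchimedeanLocalField.valueGroupWithZeroIsoInt L).strictMono.monotone

/-- `VGe i x` says `v_L(x) ≥ i`, i.e. `x ∈ P_L^i`. -/
def VGe {L : Type*} [Field L] [ValuativeRel L] [TopologicalSpace L]
    [IsNonarchimedeanLocalField L] (i : ℤ) (x : L) : Prop :=
  normVal L x ≤ WithZero.exp (-i)

/-- The unit filtration: `U_L^0` is the group of units of the ring of integers and
`U_L^n = 1 + P_L^n` for `n ≥ 1`. -/
def unitFiltration (L : Type*) [Field L] [ValuativeRel L] [TopologicalSpace L]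
    [IsNonarchimedeanLocalField L] (n : ℕ) : Set Lˣ :=
  {u | normVal L (u : L) = 1 ∧ VGe (n : ℤ) ((u : L) - 1)}

/-- The conductor of a character `χ` of `Lˣ`: the least `n ≥ 0` such that `χ` is trivial on
`U_L^n`. (Such an `n` exists for every continuous `χ`.) -/
def conductor {L : Type*} [Field L] [ValuativeRel L] [TopologicalSpace L]
    [IsNonarchimedeanLocalField L] (χ : Lˣ →* ℂˣ) : ℕ :=
  sInf {n : ℕ | ∀ u ∈ unitFiltration L n, χ u = 1}

/-- The norm group `N_{K/F}(Kˣ)`, as a subgroup of `Fˣ`. -/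
def normGroup (F K : Type*) [Field F] [Field K] [Algebra F K] : Subgroup Fˣ :=
  (Units.map (Algebra.norm F : K →* F)).range

open Classical in
/-- The quadratic character of `Fˣ` attached to a quadratic extension `K/F`: the nontrivial
character of `Fˣ / N_{K/F}(Kˣ)`. The norm group has index two by local class field theory; the
definition takes the value `1` (the trivial character) when the index is not two. -/
def quadraticCharacter (F K : Type*) [Field F] [Field K] [Algebra F K] : Fˣ →* ℂˣ :=
  if h : (normGroup F K).index = 2 then
    { toFun := fun x => if x ∈ normGroup F K then 1 else -1
      map_one' := by simp [one_mem]
      map_mul' := fun x y => by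
        have hxy := Subgroup.mul_mem_iff_of_index_two h (a := x) (b := y)
        by_cases hx : x ∈ normGroup F K <;> by_cases hy : y ∈ normGroup F K <;>
          simp [hxy, hx, hy] }
  else 1

/-- When the norm group has index two, `quadraticCharacter F K` is the unique nontrivial
character of `Fˣ` that is trivial on the norms. -/
theorem eq_quadraticCharacter_iff (F K : Type*) [Field F] [Field K] [Algebra F K]
    (h : (normGroup F K).index = 2) (ω : Fˣ →* ℂˣ) :
    ω = quadraticCharacter F K ↔ ω ≠ 1 ∧ ∀ x ∈ normGroup F K, ω x = 1 := by
  classical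
  have hq : ∀ x, quadraticCharacter F K x = if x ∈ normGroup F K then 1 else -1 := by
    intro x
    simp [quadraticCharacter, h]
  have hne : (1 : ℂˣ) ≠ -1 := by
    intro e
    have e' : (1 : ℂ) = -1 := by simpa using congrArg Units.val e
    norm_num at e'
  constructor
  · rintro rfl
    refine ⟨fun h1 => ?_, fun x hx => by rw [hq, if_pos hx]⟩
    have htop : normGroup F K = ⊤ := by
      rw [eq_top_iff]
      intro x _
      by_contra hx
      have := hq x
      rw [if_neg hx, h1] at this
      exact hne this
    rw [htop, Subgroup.index_top] at h
    omega
  · rintro ⟨hω, hN⟩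
    ext1 x
    rw [hq]
    by_cases hx : x ∈ normGroup F K
    · rw [if_pos hx, hN x hx]
    · rw [if_neg hx]
      have hsq : ω x * ω x = 1 := by
        rw [← map_mul]
        exact hN _ (Subgroup.mul_self_mem_of_index_two h x)
      have h2 : ω x = 1 ∨ ω x = -1 := by
        have h3 : (ω x : ℂ) * (ω x : ℂ) = 1 := by simpa using congrArg Units.val hsq
        rcases mul_self_eq_one_iff.mp h3 with h4 | h4
        · exact Or.inl (Units.ext h4)
        · exact Or.inr (Units.ext (by simpa using h4))
      rcases h2 with h2 | h2
      · exfalso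
        apply hω
        ext1 y
        by_cases hy : y ∈ normGroup F K
        · rw [hN y hy, MonoidHom.one_apply]
        · have hxy : x * y ∈ normGroup F K :=
            (Subgroup.mul_mem_iff_of_index_two h).mpr (by simp [hx, hy])
          have := hN _ hxy
          rw [map_mul, h2, one_mul] at this
          rw [this, MonoidHom.one_apply]
      · exact h2

/-- A character of `Kˣ` is of symplectic type if its restriction to `Fˣ` is the quadratic
character attached to `K/F`. -/
def IsSymplecticType (F K : Type*) [Field F] [Field K] [Algebra F K] (χ : Kˣ →* ℂˣ) : Prop :=
  χ.comp (Units.map (algebraMap F K : F →* K)) = quadraticCharacter F K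

/-- The ramification index `e_{K/F} = [v(Kˣ) : v(Fˣ)]`. -/
def ramificationIndex (F K : Type*) [Field F] [Field K] [Algebra F K] [ValuativeRel K]
    [TopologicalSpace K] [IsNonarchimedeanLocalField K] : ℕ :=
  ((Units.map ((normVal K : K →* ℤᵐ⁰).comp (algebraMap F K : F →* K))).range).index

/-- A quadratic extension `K/F` is wildly ramified if it is ramified and the residue
characteristic is not coprime to the degree. -/
def IsWildlyRamified (F K : Type*) [Field F] [ValuativeRel F] [TopologicalSpace F]
    [IsNonarchimedeanLocalField F] [Field K] [ValuativeRel K] [TopologicalSpace K]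
    [IsNonarchimedeanLocalField K] [Algebra F K] : Prop :=
  ramificationIndex F K ≠ 1 ∧ ¬ Nat.Coprime (ringChar 𝓀[F]) (Module.finrank F K)

/-- The ramification group `G_i` (lower numbering): all `σ` in the Galois group with
`v_K(σ α - α) ≥ i + 1` for every `α` in the ring of integers of `K`. -/
def lowerRamificationGroup (F K : Type*) [Field F] [Field K] [Algebra F K] [ValuativeRel K]
    [TopologicalSpace K] [IsNonarchimedeanLocalField K] (i : ℤ) : Set (K ≃ₐ[F] K) :=
  {σ | ∀ α : K, VGe 0 α → VGe (i + 1) (σ α - α)}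

/-- `t ≥ -1` is a ramification break of `K/F` if `G_t ≠ G_{t+1}`. -/
def IsRamificationBreak (F K : Type*) [Field F] [Field K] [Algebra F K] [ValuativeRel K]
    [TopologicalSpace K] [IsNonarchimedeanLocalField K] (t : ℤ) : Prop :=
  -1 ≤ t ∧ lowerRamificationGroup F K t ≠ lowerRamificationGroup F K (t + 1)

end

end WildQuadratic

/-!
Write `v` for the valuation of `K` and `σ` for the nontrivial automorphism. Since `e = 2`, the
valuation `v` is even on `F`, every element of `K` is `a + b π` with `a`, `b` in `F` and `π` a
uniformizer, and the two summands have valuations of different parity. This yields, without any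
appeal to the completeness of `K`, that `σ` preserves `v`, that the residue fields agree, that
`v (σ π - π) = t + 1`, and that the trace raises `v` by at least `t` (`IsWildDatum.vGe_add_apply`).

For the norm group, the element `θ = σ π / π - 1` has `v θ = t`, and since `1 + θ` has norm `1` one
gets `N (1 + b θ) = 1 + (b² - b) N θ` for `b` in `F`. The Artin–Schreier map
`b ↦ b² - b` has image of index two in the finite residue field of characteristic two, and by
Hensel's lemma a value modulo the maximal ideal is a value. So `1 + d N θ`, with `d` integral, is a
norm as soon as the class of `d` is in that image; the converse
(`IsWildDatum.one_add_mul_norm_theta_mem_range_iff`) holds because an element of norm in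
`1 + P_F^t` lies in `1 + P_K^t` and is `1 + b θ` up to higher order terms. Below level `t` the norm
induces the squaring map of the residue field, which is bijective; hence every element of `Fˣ` is a
norm times an element of `1 + P_F^t` (`IsWildDatum.exists_norm_div_sub_one`). Together these show
that the norm group has index two, contains `U_F^{t+1}` and does not contain `U_F^t`, which is the
statement on the conductor of `ω_{K/F}`.

For a symplectic `χ` only two inclusions are needed. As `U_F^n ⊆ U_K^{2n}`, a conductor at most
`2n` forces `n > t`; this gives both lower bounds. As `U_K^{2n} = U_F^n U_K^{2n+1}` for `n ≥ 1`, the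
conductor is not `2n + 1` when `n > t`; this gives the upper bound in the odd case. Continuity of
`χ` enters only to ensure that the infimum defining its conductor is attained.
-/

namespace WildQuadratic

/-! ### Normalized valuations and unit filtrations -/

section Ord

variable {L : Type*} [Field L] [ValuativeRel L] [TopologicalSpace L] [IsNonarchimedeanLocalField L]

/-- `VEq i x` says `v_L(x) = i`; in particular `x ≠ 0`. -/
def VEq (i : ℤ) (x : L) : Prop := normVal L x = WithZero.exp (-i)

lemma normVal_eq (x : L) :
    normVal L x = IsNonarchimedeanLocalField.valueGroupWithZeroIsoInt L (valuation L x) := rfl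

lemma normVal_le_iff (x y : L) : normVal L x ≤ normVal L y ↔ valuation L x ≤ valuation L y := by
  simp only [normVal_eq]
  exact (IsNonarchimedeanLocalField.valueGroupWithZeroIsoInt L).strictMono.le_iff_le

lemma exists_vEq (i : ℤ) : ∃ x : L, VEq i x := by
  obtain ⟨g, hg⟩ := (IsNonarchimedeanLocalField.valueGroupWithZeroIsoInt L).surjective
    (WithZero.exp (-i))
  obtain ⟨x, rfl⟩ := valuation_surjective g
  exact ⟨x, hg⟩

lemma exists_vEq_of_ne_zero {x : L} (hx : x ≠ 0) : ∃ i : ℤ, VEq i x :=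
  ⟨-WithZero.log (normVal L x), by
    rw [VEq, neg_neg, WithZero.exp_log ((Valuation.ne_zero_iff _).mpr hx)]⟩

lemma VEq.ne_zero {i : ℤ} {x : L} (h : VEq i x) : x ≠ 0 := by
  rintro rfl
  rw [VEq, map_zero] at h
  exact WithZero.exp_ne_zero h.symm

lemma VEq.vGe_iff {i j : ℤ} {x : L} (h : VEq i x) : VGe j x ↔ j ≤ i := by
  rw [VGe, h, WithZero.exp_le_exp]
  omega

lemma VEq.vGe {i : ℤ} {x : L} (h : VEq i x) : VGe i x := h.vGe_iff.mpr le_rfl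

lemma VEq.unique {i j : ℤ} {x : L} (h : VEq i x) (h' : VEq j x) : i = j :=
  le_antisymm (h'.vGe_iff.mp h.vGe) (h.vGe_iff.mp h'.vGe)

lemma vGe_zero (i : ℤ) : VGe i (0 : L) := by simp [VGe]

lemma VGe.mono {i j : ℤ} {x : L} (h : VGe i x) (hij : j ≤ i) : VGe j x :=
  h.trans (WithZero.exp_le_exp.mpr (by omega))

lemma vEq_of_vGe_of_not_vGe {i : ℤ} {x : L} (h : VGe i x) (h' : ¬ VGe (i + 1) x) : VEq i x := by
  obtain ⟨j, hj⟩ := exists_vEq_of_ne_zero (x := x) (by rintro rfl; exact h' (vGe_zero _))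
  rw [hj.vGe_iff] at h h'
  rwa [show i = j by omega]

lemma VGe.add {i : ℤ} {x y : L} (hx : VGe i x) (hy : VGe i y) : VGe i (x + y) :=
  (normVal L).map_add_le hx hy

lemma VGe.neg {i : ℤ} {x : L} (hx : VGe i x) : VGe i (-x) := by
  rwa [VGe, Valuation.map_neg]

lemma VGe.sub {i : ℤ} {x y : L} (hx : VGe i x) (hy : VGe i y) : VGe i (x - y) :=
  (normVal L).map_sub_le hx hy

lemma VGe.mul {i j : ℤ} {x y : L} (hx : VGe i x) (hy : VGe j y) : VGe (i + j) (x * y) := by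
  rw [VGe, map_mul, neg_add, WithZero.exp_add]
  exact mul_le_mul' hx hy

lemma VEq.mul {i j : ℤ} {x y : L} (hx : VEq i x) (hy : VEq j y) : VEq (i + j) (x * y) := by
  rw [VEq, map_mul, neg_add, WithZero.exp_add, hx, hy]

lemma VEq.inv {i : ℤ} {x : L} (hx : VEq i x) : VEq (-i) x⁻¹ := by
  rw [VEq, map_inv₀, hx, WithZero.exp_neg, WithZero.exp_neg, WithZero.exp_neg]

lemma VEq.div {i j : ℤ} {x y : L} (hx : VEq i x) (hy : VEq j y) : VEq (i - j) (x / y) := by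
  rw [div_eq_mul_inv, sub_eq_add_neg]
  exact hx.mul hy.inv

lemma VGe.div {i j : ℤ} {x y : L} (hx : VGe i x) (hy : VEq j y) : VGe (i - j) (x / y) := by
  rw [div_eq_mul_inv, sub_eq_add_neg]
  exact hx.mul hy.inv.vGe

lemma vEq_one : VEq 0 (1 : L) := by simp [VEq]

lemma VEq.pow {i : ℤ} {x : L} (hx : VEq i x) (n : ℕ) : VEq (n * i) (x ^ n) := by
  rw [VEq, map_pow, hx, ← WithZero.exp_nsmul]
  simp

lemma VEq.zpow {i : ℤ} {x : L} (hx : VEq i x) (n : ℤ) : VEq (n * i) (x ^ n) := by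
  rw [VEq, map_zpow₀, hx, ← WithZero.exp_zsmul]
  simp

lemma VEq.neg {i : ℤ} {x : L} (hx : VEq i x) : VEq i (-x) := by
  rwa [VEq, Valuation.map_neg]

lemma VEq.add_vGe {i j : ℤ} {x y : L} (hx : VEq i x) (hy : VGe j y) (hij : i < j) :
    VEq i (x + y) := by
  refine vEq_of_vGe_of_not_vGe (hx.vGe.add (hy.mono hij.le)) fun h => ?_
  have := h.sub (hy.mono (show i + 1 ≤ j by omega))
  rw [add_sub_cancel_right, hx.vGe_iff] at this
  omega

lemma VGe.of_mul_left {i j : ℤ} {x y : L} (hx : VEq i x) (h : VGe j (x * y)) : VGe (j - i) y := by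
  have := h.div hx
  rwa [mul_div_cancel_left₀ _ hx.ne_zero] at this

lemma vEq_zero_of_sub_one {x : L} (h : VGe 1 (x - 1)) : VEq 0 x := by
  have := vEq_one.add_vGe h zero_lt_one
  rwa [add_sub_cancel] at this

lemma VGe.sq_of {n : ℤ} {x : L} (h : VGe (2 * n - 1) (x ^ 2)) : VGe n x := by
  by_cases hx : x = 0
  · rw [hx]; exact vGe_zero _
  obtain ⟨j, hj⟩ := exists_vEq_of_ne_zero hx
  rw [(hj.pow 2).vGe_iff] at h
  rw [hj.vGe_iff]
  push_cast at h
  omega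

lemma mem_unitFiltration_iff {n : ℕ} {u : Lˣ} :
    u ∈ unitFiltration L n ↔ VEq 0 (u : L) ∧ VGe (n : ℤ) ((u : L) - 1) := by
  simp [unitFiltration, VEq]

lemma mem_unitFiltration_of_pos {n : ℕ} (hn : 0 < n) {u : Lˣ} (h : VGe (n : ℤ) ((u : L) - 1)) :
    u ∈ unitFiltration L n :=
  mem_unitFiltration_iff.mpr ⟨vEq_zero_of_sub_one (h.mono (by omega)), h⟩

lemma unitFiltration_antitone : Antitone (unitFiltration L) := fun m n h u hu => by
  rw [mem_unitFiltration_iff] at hu ⊢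
  exact ⟨hu.1, hu.2.mono (by exact_mod_cast h)⟩

end Ord

/-! ### The residue field in characteristic two and the Artin–Schreier map -/

section ResidueField

variable {L : Type*} [Field L] [ValuativeRel L] [TopologicalSpace L] [IsNonarchimedeanLocalField L]

lemma mem_integer_iff_vGe {x : L} : x ∈ 𝒪[L] ↔ VGe 0 x := by
  rw [Valuation.mem_integer_iff, VGe, neg_zero, WithZero.exp_zero, ← (normVal L).map_one,
    normVal_le_iff, map_one]

lemma residue_eq_zero_iff_vGe {x : 𝒪[L]} : IsLocalRing.residue 𝒪[L] x = 0 ↔ VGe 1 (x : L) := by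
  have hx : VGe 0 (x : L) := mem_integer_iff_vGe.mp x.2
  rw [IsLocalRing.residue_eq_zero_iff, IsLocalRing.mem_maximalIdeal, mem_nonunits_iff,
    (Valuation.integer.integers (valuation L)).isUnit_iff_valuation_eq_one]
  change ¬ valuation L (x : L) = 1 ↔ _
  have h1 : valuation L (x : L) = 1 ↔ VEq 0 (x : L) := by
    rw [VEq, neg_zero, WithZero.exp_zero, normVal_eq,
      map_eq_one_iff (IsNonarchimedeanLocalField.valueGroupWithZeroIsoInt L)
        (IsNonarchimedeanLocalField.valueGroupWithZeroIsoInt L).injective]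
  rw [h1]
  refine ⟨fun h => ?_, fun h h' => ?_⟩
  · by_contra hc
    exact h (vEq_of_vGe_of_not_vGe hx hc)
  · rw [h'.vGe_iff] at h
    omega

lemma charP_residueField (h2 : VGe 1 (2 : L)) : CharP 𝓀[L] 2 := by
  refine CharTwo.of_one_ne_zero_of_two_eq_zero one_ne_zero ?_
  have := (residue_eq_zero_iff_vGe (L := L) (x := 2)).mpr h2
  rwa [map_ofNat] at this

/-- In residue characteristic two every residue class is a square. -/
lemma exists_sq_vGe (h2 : VGe 1 (2 : L)) {c : L} (hc : VGe 0 c) :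
    ∃ a : L, VGe 0 a ∧ VGe 1 (c - a ^ 2) := by
  have := charP_residueField h2
  have : Fact (Nat.Prime 2) := ⟨Nat.prime_two⟩
  obtain ⟨r, hr⟩ := surjective_frobenius 𝓀[L] 2
    (IsLocalRing.residue 𝒪[L] ⟨c, mem_integer_iff_vGe.mpr hc⟩)
  obtain ⟨a, rfl⟩ := IsLocalRing.residue_surjective r
  refine ⟨a, mem_integer_iff_vGe.mp a.2, ?_⟩
  rw [frobenius_def, ← map_pow, eq_comm, ← sub_eq_zero, ← map_sub, residue_eq_zero_iff_vGe] at hr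
  exact hr

/-- `d` is congruent, modulo the maximal ideal, to a value of the Artin–Schreier polynomial
`X ^ 2 - X` on the integers. -/
def IsResidueArtinSchreier (d : L) : Prop := ∃ b : L, VGe 0 b ∧ VGe 1 (b ^ 2 - b - d)

/-- Hensel's lemma for `X ^ 2 - X - d`. -/
lemma IsResidueArtinSchreier.exists_eq (h2 : VGe 1 (2 : L)) {d : L} (hd : VGe 0 d)
    (h : IsResidueArtinSchreier d) : ∃ b : L, VGe 0 b ∧ b ^ 2 - b = d := by
  let := IsTopologicalAddGroup.rightUniformSpace L
  have := isUniformAddGroup_of_addCommGroup (G := L)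
  obtain ⟨b, hb, hbd⟩ := h
  lift b to 𝒪[L] using mem_integer_iff_vGe.mpr hb
  lift d to 𝒪[L] using mem_integer_iff_vGe.mpr hd
  open Polynomial in
  obtain ⟨a, ha, -⟩ := HenselianRing.is_henselian (I := 𝓂[L]) (X ^ 2 - X - C d : 𝒪[L][X])
    (by monicity!) b
    (by
      rw [← IsLocalRing.residue_eq_zero_iff, residue_eq_zero_iff_vGe]
      simpa using hbd)
    (by
      have : CharP 𝓀[L] 2 := charP_residueField h2
      have h0 : IsLocalRing.residue 𝒪[L] 2 = 0 := residue_eq_zero_iff_vGe.mpr h2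
      change IsUnit (IsLocalRing.residue 𝒪[L] _)
      simp [h0, one_add_one_eq_two])
  refine ⟨a, mem_integer_iff_vGe.mp a.2, ?_⟩
  have := congrArg (Subtype.val) ha
  simp only [Polynomial.eval_sub, Polynomial.eval_pow, Polynomial.eval_X, Polynomial.eval_C] at this
  push_cast at this
  linear_combination this

lemma index_range_artinSchreier {k : Type*} [Field k] [Finite k] [CharP k 2] (f : k →+ k)
    (hf : ∀ x, f x = x ^ 2 - x) : f.range.index = 2 := by
  have : f.ker.FiniteIndex := AddSubgroup.finiteIndex_of_finite
  have hker : (f.ker : Set k) = {0, 1} := by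
    ext x
    rw [SetLike.mem_coe, AddMonoidHom.mem_ker, hf, show x ^ 2 - x = x * (x - 1) by ring,
      mul_eq_zero, sub_eq_zero]
    rfl
  rw [AddSubgroup.index_range, ← SetLike.coe_sort_coe, hker, Nat.card_coe_set_eq,
    Set.ncard_pair zero_ne_one]

/-- The classes of the form `b ^ 2 - b` have index two in the residue field, as `X ^ 2 - X` has
the two roots `0` and `1`. -/
lemma exists_xor_isResidueArtinSchreier (h2 : VGe 1 (2 : L)) :
    ∃ d₀ : L, VGe 0 d₀ ∧ ∀ d d' : L, VGe 0 d → VGe 1 (d' - (d + d₀)) →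
      Xor (IsResidueArtinSchreier d') (IsResidueArtinSchreier d) := by
  have := charP_residueField h2
  have : Fact (Nat.Prime 2) := ⟨Nat.prime_two⟩
  let f : 𝓀[L] →+ 𝓀[L] := (frobenius 𝓀[L] 2 : 𝓀[L] →+ 𝓀[L]) - AddMonoidHom.id _
  have hf : ∀ x, f x = x ^ 2 - x := fun x => rfl
  have key (d : 𝒪[L]) :
      IsResidueArtinSchreier (d : L) ↔ IsLocalRing.residue 𝒪[L] d ∈ f.range := by
    constructor
    · rintro ⟨b, hb, hbd⟩
      lift b to 𝒪[L] using mem_integer_iff_vGe.mpr hb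
      refine ⟨IsLocalRing.residue _ b, ?_⟩
      rw [hf, ← map_pow, ← map_sub, ← sub_eq_zero, ← map_sub, residue_eq_zero_iff_vGe]
      exact hbd
    · rintro ⟨r, hr⟩
      obtain ⟨b, rfl⟩ := IsLocalRing.residue_surjective r
      rw [hf, ← map_pow, ← map_sub, ← sub_eq_zero, ← map_sub, residue_eq_zero_iff_vGe] at hr
      exact ⟨b, mem_integer_iff_vGe.mp b.2, hr⟩
  obtain ⟨r, hr⟩ := AddSubgroup.index_eq_two_iff.mp (index_range_artinSchreier f hf)
  obtain ⟨d₀, rfl⟩ := IsLocalRing.residue_surjective r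
  have hd₀ := mem_integer_iff_vGe.mp d₀.2
  refine ⟨d₀, hd₀, fun d d' hd hd' => ?_⟩
  have hd'0 : VGe 0 d' := by simpa using (hd'.mono zero_le_one).add (hd.add hd₀)
  lift d to 𝒪[L] using mem_integer_iff_vGe.mpr hd
  lift d' to 𝒪[L] using mem_integer_iff_vGe.mpr hd'0
  have he : IsLocalRing.residue 𝒪[L] d' =
      IsLocalRing.residue 𝒪[L] d + IsLocalRing.residue 𝒪[L] d₀ := by
    rw [← sub_eq_zero, ← map_add, ← map_sub, residue_eq_zero_iff_vGe]
    exact hd'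
  rw [key, key, he]
  exact hr _

end ResidueField

/-! ### The value group of a ramified quadratic extension -/

lemma exists_eq_add_mul_of_notMem_range {F K : Type*} [Field F] [Field K] [Algebra F K]
    [Algebra.IsQuadraticExtension F K] {π : K}
    (hπ : ∀ x : F, algebraMap F K x ≠ π) (x : K) :
    ∃ a b : F, x = algebraMap F K a + algebraMap F K b * π := by
  have hli : LinearIndependent F ![(1 : K), π] := by
    rw [LinearIndependent.pair_iff]
    intro a b h
    rw [Algebra.smul_def, Algebra.smul_def, mul_one] at h
    have hb : b = 0 := by
      by_contra hb
      refine hπ (-a / b) ?_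
      have hb' : algebraMap F K b ≠ 0 := (map_ne_zero _).mpr hb
      rw [map_div₀, map_neg, div_eq_iff hb']
      linear_combination -h
    rw [hb, map_zero, zero_mul, add_zero, map_eq_zero] at h
    exact ⟨h, hb⟩
  have hspan := hli.span_eq_top_of_card_eq_finrank (by
    rw [Algebra.IsQuadraticExtension.finrank_eq_two, Fintype.card_fin])
  have hx : x ∈ Submodule.span F (Set.range ![(1 : K), π]) := hspan ▸ Submodule.mem_top
  rw [Matrix.range_cons, Matrix.range_cons, Matrix.range_empty, Set.union_empty,
    Set.singleton_union, Submodule.mem_span_pair] at hx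
  obtain ⟨a, b, rfl⟩ := hx
  exact ⟨a, b, by rw [Algebra.smul_def, Algebra.smul_def, mul_one]⟩

section Extension

variable {F K : Type*}
  [Field F] [ValuativeRel F] [TopologicalSpace F] [IsNonarchimedeanLocalField F]
  [Field K] [ValuativeRel K] [TopologicalSpace K] [IsNonarchimedeanLocalField K]
  [Algebra F K]

/-- In a ramified quadratic extension the valuation of `K` restricts to twice that of `F`. -/
lemma vEq_algebraMap [ValuativeExtension F K] [Algebra.IsQuadraticExtension F K]
    (hram : ramificationIndex F K ≠ 1) {x : F} {i : ℤ} (hx : VEq i x) :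
    VEq (2 * i) (algebraMap F K x) := by
  obtain ⟨ϖ, hϖ⟩ := exists_vEq (L := F) 1
  have hle (x y : F) : normVal K (algebraMap F K x) ≤ normVal K (algebraMap F K y) ↔
      normVal F x ≤ normVal F y := by
    rw [normVal_le_iff, normVal_le_iff, ← Valuation.Compatible.vle_iff_le,
      ← Valuation.Compatible.vle_iff_le, ValuativeExtension.vle_iff_vle]
  have heq (x y : F) (h : normVal F x = normVal F y) :
      normVal K (algebraMap F K x) = normVal K (algebraMap F K y) :=
    le_antisymm ((hle x y).mpr h.le) ((hle y x).mpr h.ge)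
  obtain ⟨e, he⟩ := exists_vEq_of_ne_zero ((map_ne_zero (algebraMap F K)).mpr hϖ.ne_zero)
  have hmul {x : F} {i : ℤ} (hx : VEq i x) : VEq (i * e) (algebraMap F K x) := by
    have h1 := hϖ.zpow i
    rw [mul_one] at h1
    have h2 := heq x (ϖ ^ i) (hx.trans h1.symm)
    have h3 := he.zpow i
    rw [← map_zpow₀] at h3
    exact h2.trans h3
  have hepos : 0 < e := by
    by_contra hc
    have h1 : normVal K (algebraMap F K 1) ≤ normVal K (algebraMap F K ϖ) := by
      rw [map_one, map_one, he, ← WithZero.exp_zero, WithZero.exp_le_exp]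
      omega
    rw [hle, hϖ, map_one, ← WithZero.exp_zero, WithZero.exp_le_exp] at h1
    omega
  have hene : e ≠ 1 := by
    rintro rfl
    refine hram ?_
    rw [ramificationIndex, Subgroup.index_eq_one, MonoidHom.range_eq_top]
    intro g
    obtain ⟨x, hx⟩ := exists_vEq (L := F) (-WithZero.log (g : ℤᵐ⁰))
    refine ⟨Units.mk0 x hx.ne_zero, Units.ext ?_⟩
    have := hmul hx
    rw [mul_one, VEq, neg_neg, WithZero.exp_log g.ne_zero] at this
    exact this
  -- A uniformizer satisfies a quadratic equation over `F`; comparing valuations gives `e ∣ 2`.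
  obtain ⟨π, hπ⟩ := exists_vEq (L := K) 1
  have hndvd (j : ℤ) (h : j * e = 1) : False := by
    have : e ∣ 1 := ⟨j, by linarith⟩
    have := Int.le_of_dvd one_pos this
    omega
  have hπF (x : F) : algebraMap F K x ≠ π := by
    rintro rfl
    have hx : x ≠ 0 := by
      rintro rfl
      exact hπ.ne_zero (map_zero _)
    obtain ⟨j, hj⟩ := exists_vEq_of_ne_zero hx
    exact hndvd j ((hmul hj).unique hπ)
  obtain ⟨a, b, hab⟩ := exists_eq_add_mul_of_notMem_range hπF (π ^ 2)
  have hπ2 : VEq 2 (π ^ 2) := by simpa using hπ.pow 2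
  have hdvd : e ∣ 2 := by
    by_cases hb : b = 0
    · rw [hb, map_zero, zero_mul, add_zero] at hab
      have ha : a ≠ 0 := by
        rintro rfl
        rw [map_zero] at hab
        exact hπ2.ne_zero hab
      obtain ⟨i, hi⟩ := exists_vEq_of_ne_zero ha
      rw [hab] at hπ2
      exact ⟨i, by rw [hπ2.unique (hmul hi), mul_comm]⟩
    obtain ⟨j, hj⟩ := exists_vEq_of_ne_zero hb
    have hbπ := (hmul hj).mul hπ
    by_cases ha : a = 0
    · rw [ha, map_zero, zero_add] at hab
      rw [hab] at hπ2
      exact (hndvd j (by linarith [hπ2.unique hbπ])).elim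
    obtain ⟨i, hi⟩ := exists_vEq_of_ne_zero ha
    have hia := hmul hi
    rw [hab] at hπ2
    rcases lt_trichotomy (i * e) (j * e + 1) with h | h | h
    · exact ⟨i, by rw [hπ2.unique (hia.add_vGe hbπ.vGe h), mul_comm]⟩
    · exact (hndvd (i - j) (by linarith)).elim
    · rw [add_comm] at hπ2
      exact (hndvd j (by linarith [hπ2.unique (hbπ.add_vGe hia.vGe h)])).elim
  have := Int.le_of_dvd two_pos hdvd
  rw [mul_comm, show (2 : ℤ) = e by omega]
  exact hmul hx


/-! ### Conjugation, norm and trace in a ramified quadratic extension -/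

variable (F) in
/-- The data attached to a ramified quadratic extension `K/F`: the nontrivial automorphism `σ` and
a uniformizer `π` of `K`, where the valuation of `K` restricts to twice that of `F`. -/
structure IsRamifiedDatum (σ : K ≃ₐ[F] K) (π : K) : Prop where
  vEq_map {x : F} {i : ℤ} (hx : VEq i x) : VEq (2 * i) (algebraMap F K x)
  vEq_unif : VEq 1 π
  eq_one_or (τ : K ≃ₐ[F] K) : τ = 1 ∨ τ = σ
  ne_one : σ ≠ 1

namespace IsRamifiedDatum

variable {σ : K ≃ₐ[F] K} {π : K} (D : IsRamifiedDatum F σ π)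

section
include D

lemma vGe_map_iff {x : F} {i : ℤ} : VGe (2 * i) (algebraMap F K x) ↔ VGe i x := by
  by_cases hx : x = 0
  · simp [hx, vGe_zero]
  obtain ⟨j, hj⟩ := exists_vEq_of_ne_zero hx
  rw [hj.vGe_iff, (D.vEq_map hj).vGe_iff]
  omega

lemma vGe_of_map {x : F} {i j : ℤ} (h : VGe j (algebraMap F K x)) (hij : 2 * i - 1 ≤ j) :
    VGe i x := by
  by_cases hx : x = 0
  · rw [hx]; exact vGe_zero _
  obtain ⟨k, hk⟩ := exists_vEq_of_ne_zero hx
  rw [(D.vEq_map hk).vGe_iff] at h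
  rw [hk.vGe_iff]
  omega

lemma vEq_iff_map {x : F} {i : ℤ} : VEq (2 * i) (algebraMap F K x) ↔ VEq i x := by
  refine ⟨fun h => ?_, D.vEq_map⟩
  obtain ⟨j, hj⟩ := exists_vEq_of_ne_zero ((map_ne_zero (algebraMap F K)).mp h.ne_zero)
  have := h.unique (D.vEq_map hj)
  rwa [show i = j by omega]

lemma not_vEq_map_odd {x : F} {i : ℤ} (hi : Odd i) : ¬ VEq i (algebraMap F K x) := fun h => by
  obtain ⟨j, hj⟩ := exists_vEq_of_ne_zero ((map_ne_zero (algebraMap F K)).mp h.ne_zero)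
  have := h.unique (D.vEq_map hj)
  obtain ⟨k, hk⟩ := hi
  omega

lemma exists_eq_add_mul [Algebra.IsQuadraticExtension F K] {x : K} {i : ℤ} (hx : VGe i x) :
    ∃ a b : F, x = algebraMap F K a + algebraMap F K b * π ∧
      VGe i (algebraMap F K a) ∧ VGe (i - 1) (algebraMap F K b) := by
  obtain ⟨a, b, rfl⟩ := exists_eq_add_mul_of_notMem_range (π := π) (F := F)
    (fun x hx => D.not_vEq_map_odd odd_one (hx ▸ D.vEq_unif)) x
  refine ⟨a, b, rfl, ?_⟩
  by_cases hb : b = 0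
  · rw [hb, map_zero, zero_mul, add_zero] at hx
    exact ⟨hx, by rw [hb, map_zero]; exact vGe_zero _⟩
  obtain ⟨j, hj⟩ := exists_vEq_of_ne_zero hb
  have hbπ := (D.vEq_map hj).mul D.vEq_unif
  suffices h : i ≤ 2 * j + 1 by
    refine ⟨?_, (D.vEq_map hj).vGe_iff.mpr (by omega)⟩
    simpa using hx.sub (hbπ.vGe_iff.mpr h)
  by_contra! h
  -- The two summands have valuations of different parity, so they cannot cancel.
  refine D.not_vEq_map_odd (x := a) (i := 2 * j + 1) ⟨j, rfl⟩ ?_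
  simpa using (hbπ.neg.add_vGe hx h)

/-- The residue fields of `F` and `K` agree. -/
lemma exists_vGe_sub_map [Algebra.IsQuadraticExtension F K] {x : K} (hx : VGe 0 x) :
    ∃ a : F, VGe 0 a ∧ VGe 1 (x - algebraMap F K a) := by
  obtain ⟨a, b, rfl, ha, hb⟩ := D.exists_eq_add_mul hx
  refine ⟨a, D.vGe_of_map ha (by omega), ?_⟩
  have hb0 : VGe 0 b := D.vGe_of_map hb (by omega)
  rw [add_sub_cancel_left]
  simpa using (D.vGe_map_iff.mpr hb0).mul D.vEq_unif.vGe

/-- `v_K(σ α - α) - v_K(α)` is at least `v_K(σ π - π) - 1`. -/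
lemma vGe_apply_sub [Algebra.IsQuadraticExtension F K] {s i : ℤ} (hs : VGe s (σ π - π)) {x : K}
    (hx : VGe i x) :
    VGe (i - 1 + s) (σ x - x) := by
  obtain ⟨a, b, rfl, ha, hb⟩ := D.exists_eq_add_mul hx
  rw [map_add, map_mul, σ.commutes, σ.commutes, add_sub_add_left_eq_sub, ← mul_sub]
  exact hb.mul hs

lemma vGe_apply_sub_of_integer [Algebra.IsQuadraticExtension F K] {s : ℤ}
    (hs : VGe s (σ π - π)) {x : K} (hx : VGe 0 x) :
    VGe s (σ x - x) := by
  obtain ⟨a, b, rfl, ha, hb⟩ := D.exists_eq_add_mul hx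
  have hb0 : VGe 0 b := D.vGe_of_map hb (by omega)
  rw [map_add, map_mul, σ.commutes, σ.commutes, add_sub_add_left_eq_sub, ← mul_sub]
  simpa using (D.vGe_map_iff.mpr hb0).mul hs

lemma apply_apply (x : K) : σ (σ x) = x := by
  rcases D.eq_one_or (σ * σ) with h | h
  · exact DFunLike.congr_fun h x
  · exact (D.ne_one (mul_eq_left.mp h)).elim

lemma norm_eq [Algebra.IsQuadraticExtension F K] [IsGalois F K] (x : K) :
    algebraMap F K (Algebra.norm F x) = x * σ x := by
  classical
  have huniv : (Finset.univ : Finset (K ≃ₐ[F] K)) = {1, σ} := by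
    ext τ
    simpa using D.eq_one_or τ
  rw [Algebra.norm_eq_prod_automorphisms, huniv, Finset.prod_pair D.ne_one.symm]
  rfl

lemma trace_eq [Algebra.IsQuadraticExtension F K] [IsGalois F K] (x : K) :
    algebraMap F K (Algebra.trace F K x) = x + σ x := by
  classical
  have huniv : (Finset.univ : Finset (K ≃ₐ[F] K)) = {1, σ} := by
    ext τ
    simpa using D.eq_one_or τ
  rw [trace_eq_sum_automorphisms, huniv, Finset.sum_pair D.ne_one.symm]
  rfl

variable [Algebra.IsQuadraticExtension F K] [IsGalois F K]

/-- The trace and the norm of `π` lie in `F`, so have even valuation; this forces `σ π` to have the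
same valuation as `π`. -/
lemma vEq_apply_unif : VEq 1 (σ π) := by
  obtain ⟨j, hj⟩ := exists_vEq_of_ne_zero
    ((map_ne_zero σ).mpr D.vEq_unif.ne_zero)
  have hN := D.vEq_unif.mul hj
  rw [← D.norm_eq] at hN
  have hjodd : Odd j := by
    by_contra hc
    rw [Int.not_odd_iff_even] at hc
    exact D.not_vEq_map_odd (odd_one.add_even hc) hN
  rcases lt_trichotomy j 1 with h | rfl | h
  · have := hj.add_vGe D.vEq_unif.vGe h
    rw [add_comm, ← D.trace_eq] at this
    exact (D.not_vEq_map_odd hjodd this).elim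
  · exact hj
  · have := D.vEq_unif.add_vGe hj.vGe h
    rw [← D.trace_eq] at this
    exact (D.not_vEq_map_odd odd_one this).elim

lemma vGe_apply {x : K} {i : ℤ} (hx : VGe i x) : VGe i (σ x) := by
  obtain ⟨a, b, rfl, ha, hb⟩ := D.exists_eq_add_mul hx
  rw [map_add, map_mul, σ.commutes, σ.commutes]
  refine ha.add ?_
  simpa using hb.mul D.vEq_apply_unif.vGe

lemma vEq_apply {x : K} {i : ℤ} (hx : VEq i x) : VEq i (σ x) := by
  refine vEq_of_vGe_of_not_vGe (D.vGe_apply hx.vGe) fun h => ?_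
  have := D.vGe_apply h
  rw [D.apply_apply, hx.vGe_iff] at this
  omega

lemma vEq_norm {x : K} {i : ℤ} (hx : VEq i x) : VEq i (Algebra.norm F x) := by
  rw [← D.vEq_iff_map, D.norm_eq, two_mul]
  exact hx.mul (D.vEq_apply hx)

end
end IsRamifiedDatum

/-! ### The ramification break -/

variable (F) in
/-- The data attached to a wildly ramified quadratic extension `K/F` with ramification break `t`. -/
structure IsWildDatum (σ : K ≃ₐ[F] K) (π : K) (t : ℕ) : Prop extends IsRamifiedDatum F σ π where
  vEq_sub : VEq (t + 1) (σ π - π)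
  vGe_two : VGe 1 (2 : F)

lemma IsWildDatum.vGe_one_two {σ : K ≃ₐ[F] K} {π : K} {t : ℕ} (D : IsWildDatum F σ π t) :
    VGe 1 (2 : K) := by
  have := D.vGe_map_iff.mpr D.vGe_two
  rw [map_ofNat] at this
  exact this.mono (by norm_num)

variable [Algebra.IsQuadraticExtension F K]

lemma exists_isWildDatum [ValuativeExtension F K] [CharZero F]
    (hwild : IsWildlyRamified F K) {t : ℤ} (ht : IsRamificationBreak F K t) :
    ∃ (σ : K ≃ₐ[F] K) (π : K) (n : ℕ), (n : ℤ) = t ∧ IsWildDatum F σ π n := by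
  obtain ⟨π, hπ⟩ := exists_vEq (L := K) 1
  have hsub : lowerRamificationGroup F K (t + 1) ⊆ lowerRamificationGroup F K t :=
    fun σ hσ α hα => (hσ α hα).mono (by omega)
  obtain ⟨σ, hσ, hσ'⟩ := Set.exists_of_ssubset (hsub.ssubset_of_ne ht.2.symm)
  have hne : σ ≠ 1 := by
    rintro rfl
    exact hσ' fun α _ => by simpa using vGe_zero _
  have hcard : Nat.card (K ≃ₐ[F] K) = 2 := by
    rw [IsGalois.card_aut_eq_finrank, Algebra.IsQuadraticExtension.finrank_eq_two]
  have D : IsRamifiedDatum F σ π := by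
    refine ⟨vEq_algebraMap hwild.1, hπ, fun τ => ?_, hne⟩
    by_contra! h
    obtain ⟨x, y, hxy, huniv⟩ := Nat.card_eq_two_iff.mp hcard
    have h1 (τ : K ≃ₐ[F] K) : τ = x ∨ τ = y := by
      have := Set.mem_univ τ
      rw [← huniv] at this
      simpa using this
    have := h1 1
    have := h1 σ
    have := h1 τ
    grind
  have hge : VGe (t + 1) (σ π - π) := hσ π (hπ.vGe.mono zero_le_one)
  have hEq : VEq (t + 1) (σ π - π) := by
    refine vEq_of_vGe_of_not_vGe hge fun h => hσ' fun α hα => ?_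
    exact D.vGe_apply_sub_of_integer h hα
  have ht0 : 0 ≤ t := by
    have := D.vEq_apply_unif.vGe.sub hπ.vGe
    rw [hEq.vGe_iff] at this
    omega
  lift t to ℕ using ht0
  refine ⟨σ, π, t, rfl, D, hEq, ?_⟩
  have hdvd : ringChar 𝓀[F] ∣ 2 := by
    have hp : (ringChar 𝓀[F]).Prime := CharP.prime_ringChar _
    have := hwild.2
    rw [Algebra.IsQuadraticExtension.finrank_eq_two, hp.coprime_iff_not_dvd, not_not] at this
    exact this
  have h2 : IsLocalRing.residue 𝒪[F] 2 = 0 := by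
    rw [map_ofNat]
    exact_mod_cast (ringChar.spec 𝓀[F] 2).mpr hdvd
  exact residue_eq_zero_iff_vGe.mp h2

end Extension

/-! ### The norm group -/

lemma mem_normGroup_iff {F K : Type*} [Field F] [Field K] [Algebra F K]
    [FiniteDimensional F K] {u : Fˣ} : u ∈ normGroup F K ↔ ∃ y : K, Algebra.norm F y = u := by
  constructor
  · rintro ⟨y, rfl⟩
    exact ⟨y, rfl⟩
  · rintro ⟨y, hy⟩
    have hy0 : y ≠ 0 := by
      rintro rfl
      rw [Algebra.norm_zero] at hy
      exact u.ne_zero hy.symm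
    exact ⟨Units.mk0 y hy0, Units.ext hy⟩

section Norm

variable {F K : Type*}
  [Field F] [ValuativeRel F] [TopologicalSpace F] [IsNonarchimedeanLocalField F]
  [Field K] [ValuativeRel K] [TopologicalSpace K] [IsNonarchimedeanLocalField K]
  [Algebra F K] [Algebra.IsQuadraticExtension F K] [IsGalois F K]

namespace IsWildDatum

variable {σ : K ≃ₐ[F] K} {π : K} {t : ℕ} (D : IsWildDatum F σ π t)
include D

/-- `v_K(2) ≥ t`. -/
lemma vGe_break_two : VGe (t : ℤ) (2 : K) := by
  have h2 : algebraMap F K 2 = 2 := map_ofNat _ 2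
  by_contra h
  have hne : (2 : K) ≠ 0 := fun h0 => h (h0 ▸ vGe_zero _)
  obtain ⟨j, hj⟩ := exists_vEq_of_ne_zero hne
  rw [hj.vGe_iff] at h
  -- Otherwise `2π + (σ π - π)`, the trace of `π`, has odd valuation.
  have hodd : Odd (j + 1) := by
    by_contra hc
    rw [Int.not_odd_iff_even, Int.even_add_one, Int.not_even_iff_odd] at hc
    exact D.not_vEq_map_odd hc (h2 ▸ hj)
  have := (hj.mul D.vEq_unif).add_vGe D.vEq_sub.vGe (by omega)
  rw [show 2 * π + (σ π - π) = π + σ π by ring, ← D.trace_eq] at this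
  exact D.not_vEq_map_odd hodd this

/-- The trace of `K/F` maps `P_K^n` into `P_K^{n+t}`. -/
lemma vGe_add_apply {x : K} {n : ℤ} (hx : VGe n x) : VGe (n + t) (x + σ x) := by
  have h1 := hx.mul D.vGe_break_two
  have h2 := D.vGe_apply_sub D.vEq_sub.vGe hx
  rw [show n - 1 + (t + 1 : ℤ) = n + t by ring] at h2
  rw [show x + σ x = x * 2 + (σ x - x) by ring]
  exact h1.add h2

/-- A unit whose norm is a principal unit is a principal unit: modulo the maximal ideal the norm is
the squaring map, which is injective. -/
lemma vGe_one_sub_one_of_norm {y : K} (hy : VGe 0 y) (hN : VGe 1 (y * σ y - 1)) :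
    VGe 1 (y - 1) := by
  obtain ⟨a, ha, hr⟩ := D.exists_vGe_sub_map hy
  have ha' : VGe 0 (algebraMap F K a) := by simpa using D.vGe_map_iff.mpr ha
  set r := y - algebraMap F K a with hrdef
  have hyr : y = algebraMap F K a + r := by rw [hrdef]; ring
  have hσr := D.vGe_apply hr
  have hsq : VGe 1 ((algebraMap F K a - 1) ^ 2) := by
    have e : (algebraMap F K a - 1) ^ 2 = (y * σ y - 1) - r * σ y - algebraMap F K a * σ r
        - 2 * (algebraMap F K a - 1) := by
      rw [hyr, map_add, σ.commutes]
      ring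
    rw [e]
    have h1 : VGe 1 (r * σ y) := by simpa using hr.mul (D.vGe_apply hy)
    have h2 : VGe 1 (algebraMap F K a * σ r) := by simpa using ha'.mul hσr
    have h3 : VGe 1 (2 * (algebraMap F K a - 1)) := by
      simpa using D.vGe_one_two.mul (ha'.sub vEq_one.vGe)
    exact ((hN.sub h1).sub h2).sub h3
  rw [hyr, add_sub_right_comm]
  exact VGe.add (VGe.sq_of (by simpa using hsq)) hr

/-- The element `θ = σ π / π - 1` has valuation `t`; the equation says that `1 + θ = σ π / π` has
norm `1`. -/
lemma exists_theta : ∃ θ : K, VEq (t : ℤ) θ ∧ θ + σ θ + θ * σ θ = 0 := by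
  have hπ := D.vEq_unif.ne_zero
  have hσπ := D.vEq_apply_unif.ne_zero
  refine ⟨(σ π - π) / π, by simpa using D.vEq_sub.div D.vEq_unif, ?_⟩
  rw [map_div₀, map_sub, D.apply_apply]
  field_simp
  ring

lemma break_pos : 0 < t := by
  by_contra hc
  obtain ⟨θ, hθ, h⟩ := D.exists_theta
  have ht : t = 0 := by omega
  rw [ht, Nat.cast_zero] at hθ
  have := D.vGe_one_sub_one_of_norm (y := 1 + θ) (vEq_one.vGe.add hθ.vGe) (by
    rw [map_add, map_one, show (1 + θ) * (1 + σ θ) - 1 = θ + σ θ + θ * σ θ by ring, h]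
    exact vGe_zero _)
  rw [add_sub_cancel_left, hθ.vGe_iff] at this
  omega

/-- On `1 + F θ` the norm is the Artin–Schreier polynomial: `N(1 + b θ) = 1 + (b² - b) N(θ)`. -/
lemma norm_one_add_mul {θ : K} (hθ : θ + σ θ + θ * σ θ = 0) (b : F) :
    Algebra.norm F (1 + algebraMap F K b * θ) = 1 + (b ^ 2 - b) * Algebra.norm F θ := by
  apply (algebraMap F K).injective
  simp only [D.norm_eq, map_add, map_mul, map_one, map_sub, map_pow, σ.commutes]
  linear_combination algebraMap F K b * hθ

/-- A unit `y` of `K` with `N(y) ∈ 1 + P_F^t` lies in `1 + P_K^t`: below level `t` the norm induces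
injective maps on the graded pieces of the unit filtrations. -/
lemma vGe_sub_one_of_norm {y : K} (hy : VGe 0 y) (hN : VGe (2 * t : ℤ) (y * σ y - 1)) :
    VGe (t : ℤ) (y - 1) := by
  have ht := D.break_pos
  suffices h : ∀ n : ℕ, 1 ≤ n → n ≤ t → VGe (n : ℤ) (y - 1) from h t ht le_rfl
  intro n hn
  induction n, hn using Nat.le_induction with
  | base =>
    intro _
    exact_mod_cast D.vGe_one_sub_one_of_norm hy (hN.mono (by omega))
  | succ n hn ih =>
    intro hnt
    have hx := ih (by omega)
    set x := y - 1 with hxdef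
    by_contra hc
    have hx' : VEq (n : ℤ) x := vEq_of_vGe_of_not_vGe hx (by exact_mod_cast hc)
    have hNx := hx'.mul (D.vEq_apply hx')
    have e : x * σ x = (y * σ y - 1) - (x + σ x) := by
      rw [show y = 1 + x by rw [hxdef]; ring, map_add, map_one]
      ring
    have h1 : VGe (2 * n + 1 : ℤ) (x * σ x) := by
      rw [e]
      exact (hN.mono (by omega)).sub ((D.vGe_add_apply hx).mono (by omega))
    rw [hNx.vGe_iff] at h1
    omega

/-- An element `1 + d N(θ)` of `1 + P_F^t` is a norm if and only if the class of `d` in the residue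
field has the form `b² - b`. -/
lemma one_add_mul_norm_theta_mem_range_iff {θ : K} (hθt : VEq (t : ℤ) θ)
    (hθ : θ + σ θ + θ * σ θ = 0) {d : F} (hd : VGe 0 d) :
    (∃ y : K, Algebra.norm F y = 1 + d * Algebra.norm F θ) ↔ IsResidueArtinSchreier d := by
  have ht := D.break_pos
  have hν := D.vEq_norm hθt
  constructor
  · rintro ⟨y, hy⟩
    have hyK : y * σ y = 1 + algebraMap F K d * (θ * σ θ) := by
      rw [← D.norm_eq, hy, map_add, map_one, map_mul, D.norm_eq]
    have hd' := D.vGe_map_iff.mpr hd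
    have hνK := hθt.mul (D.vEq_apply hθt)
    have hN : VGe (2 * t : ℤ) (y * σ y - 1) := by
      rw [hyK, add_sub_cancel_left]
      exact (hd'.mul hνK.vGe).mono (by omega)
    have hy0 : VGe 0 y := by
      have h0 : VEq 0 (y * σ y) := vEq_zero_of_sub_one (hN.mono (by omega))
      obtain ⟨j, hj⟩ := exists_vEq_of_ne_zero (left_ne_zero_of_mul h0.ne_zero)
      have := h0.unique (hj.mul (D.vEq_apply hj))
      rw [hj.vGe_iff]
      omega
    have hx := D.vGe_sub_one_of_norm hy0 hN
    have hq := hx.div hθt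
    rw [sub_self] at hq
    obtain ⟨b, hb, hr⟩ := D.exists_vGe_sub_map hq
    set r := (y - 1) / θ - algebraMap F K b with hrdef
    have hyr : y = (1 + algebraMap F K b * θ) + r * θ := by
      have := hθt.ne_zero
      rw [hrdef]
      field_simp
      ring
    have hb' := D.vGe_map_iff.mpr hb
    refine ⟨b, hb, ?_⟩
    -- Replacing `y` by `1 + b θ` changes its norm by an element of `P_F^(t+1)`.
    have hz : VGe (t + 1 : ℤ) (r * θ) := by
      rw [add_comm]
      exact hr.mul hθt.vGe
    have hbθ : VGe 0 (1 + algebraMap F K b * θ) :=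
      vEq_one.vGe.add ((hb'.mul hθt.vGe).mono (by omega))
    have hw := D.vGe_add_apply ((D.vGe_apply hbθ).mul hz)
    have hzz := hz.mul (D.vGe_apply hz)
    have hcongr : VGe (2 * t + 1 : ℤ) (algebraMap F K ((b ^ 2 - b - d) * Algebra.norm F θ)) := by
      have e : algebraMap F K ((b ^ 2 - b - d) * Algebra.norm F θ) =
          -((σ (1 + algebraMap F K b * θ) * (r * θ) +
            σ (σ (1 + algebraMap F K b * θ) * (r * θ))) + r * θ * σ (r * θ)) := by
        have e2 : (b ^ 2 - b - d) * Algebra.norm F θ =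
            Algebra.norm F (1 + algebraMap F K b * θ) - Algebra.norm F y := by
          rw [hy, D.norm_one_add_mul hθ]
          ring
        rw [e2, map_sub, D.norm_eq, D.norm_eq, map_mul σ (σ _), D.apply_apply]
        have hσy : σ y = σ (1 + algebraMap F K b * θ) + σ (r * θ) := by
          rw [← map_add, ← hyr]
        rw [hσy]
        conv_lhs => rw [hyr]
        ring
      rw [e]
      exact ((hw.mono (by omega)).add (hzz.mono (by omega))).neg
    have h1 : VGe (t + 1 : ℤ) ((b ^ 2 - b - d) * Algebra.norm F θ) :=
      D.vGe_of_map hcongr (by omega)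
    rw [mul_comm] at h1
    simpa using VGe.of_mul_left hν h1
  · intro h
    obtain ⟨b, -, rfl⟩ := h.exists_eq D.vGe_two hd
    exact ⟨_, D.norm_one_add_mul hθ b⟩

/-- Every element of `Fˣ` is the product of a norm and an element of `1 + P_F^t`: below level `t`
the norm is, on the graded pieces, the squaring map of the residue field, up to a scalar. -/
lemma exists_norm_div_sub_one (n : ℕ) (hn : 1 ≤ n) (hnt : n ≤ t) {u : F} (hu : u ≠ 0) :
    ∃ y : K, y ≠ 0 ∧ VGe (n : ℤ) (u / Algebra.norm F y - 1) := by
  have hnorm {y : K} (hy : y ≠ 0) : Algebra.norm F y ≠ 0 := Algebra.norm_ne_zero_iff.mpr hy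
  induction n, hn using Nat.le_induction with
  | base =>
    obtain ⟨k, hk⟩ := exists_vEq_of_ne_zero hu
    have hπk : VEq k (π ^ k) := by simpa using D.vEq_unif.zpow k
    have hv := hk.div (D.vEq_norm hπk)
    rw [sub_self] at hv
    obtain ⟨a, ha, hc⟩ := exists_sq_vGe D.vGe_two hv.vGe
    set v := u / Algebra.norm F (π ^ k) with hvdef
    have ha2 : VEq 0 (a ^ 2) := by
      simpa using hv.add_vGe hc.neg zero_lt_one
    have ha0 : a ≠ 0 := fun h => ha2.ne_zero (by simp [h])
    have ha0' : algebraMap F K a ≠ 0 := (map_ne_zero _).mpr ha0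
    refine ⟨π ^ k * algebraMap F K a, mul_ne_zero hπk.ne_zero ha0', ?_⟩
    rw [map_mul, Algebra.norm_algebraMap, Algebra.IsQuadraticExtension.finrank_eq_two,
      ← div_div, ← hvdef, div_sub_one ha2.ne_zero]
    simpa using hc.div ha2
  | succ n hn ih =>
    obtain ⟨y, hy, hc⟩ := ih (by omega)
    set c := u / Algebra.norm F y - 1 with hcdef
    have hπn : VEq (n : ℤ) (π ^ n) := by simpa using D.vEq_unif.pow n
    have hNπ := D.vEq_norm hπn
    have hq := hc.div hNπ
    rw [sub_self] at hq
    obtain ⟨a, ha, hr⟩ := exists_sq_vGe D.vGe_two hq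
    set x := algebraMap F K a * π ^ n with hxdef
    have hx : VGe (n : ℤ) x := by
      simpa using (D.vGe_map_iff.mpr ha).mul hπn.vGe
    have hx1 : VEq 0 (1 + x) := vEq_one.add_vGe hx (by omega)
    have hN1 := D.vEq_norm hx1
    have htr : VGe (n + 1 : ℤ) (Algebra.trace F K x) := by
      have := D.vGe_add_apply hx
      rw [← D.trace_eq] at this
      exact D.vGe_of_map this (by omega)
    have hNx : Algebra.norm F (1 + x) =
        1 + Algebra.trace F K x + a ^ 2 * Algebra.norm F (π ^ n) := by
      have hN : a ^ 2 * Algebra.norm F (π ^ n) = Algebra.norm F x := by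
        rw [hxdef, map_mul, Algebra.norm_algebraMap, Algebra.IsQuadraticExtension.finrank_eq_two]
      rw [hN]
      apply (algebraMap F K).injective
      simp only [D.norm_eq, D.trace_eq, map_add, map_one]
      ring
    refine ⟨y * (1 + x), mul_ne_zero hy hx1.ne_zero, ?_⟩
    have hdiff : VGe (n + 1 : ℤ) (1 + c - Algebra.norm F (1 + x)) := by
      have e : 1 + c - Algebra.norm F (1 + x) =
          (c / Algebra.norm F (π ^ n) - a ^ 2) * Algebra.norm F (π ^ n)
            - Algebra.trace F K x := by
        have := hNπ.ne_zero
        rw [hNx]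
        field_simp
        ring
      rw [e]
      refine VGe.sub ?_ htr
      rw [add_comm]
      exact hr.mul hNπ.vGe
    have e : u / Algebra.norm F (y * (1 + x)) - 1 =
        (1 + c - Algebra.norm F (1 + x)) / Algebra.norm F (1 + x) := by
      have := hnorm hy
      have := hN1.ne_zero
      rw [map_mul, hcdef]
      field_simp
      ring
    rw [e, Nat.cast_succ]
    simpa using hdiff.div hN1

/-- The shape of the norm group near level `t`: the quotient of `1 + P_F^t` by its norms is the
cokernel of `b ↦ b² - b` on the residue field. -/
lemma exists_norm_theta : ∃ ν : F, VEq (t : ℤ) ν ∧ ∀ u : Fˣ, ∀ d : F, VGe 0 d →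
    (u : F) = 1 + d * ν → (u ∈ normGroup F K ↔ IsResidueArtinSchreier d) := by
  obtain ⟨θ, hθt, hθ⟩ := D.exists_theta
  refine ⟨Algebra.norm F θ, D.vEq_norm hθt, fun u d hd hu => ?_⟩
  rw [mem_normGroup_iff, hu, D.one_add_mul_norm_theta_mem_range_iff hθt hθ hd]

/-- The fundamental index equality of local class field theory for `K/F`. -/
lemma index_normGroup : (normGroup F K).index = 2 := by
  have ht := D.break_pos
  obtain ⟨ν, hν, key⟩ := D.exists_norm_theta
  obtain ⟨d₀, hd₀, hxor⟩ := exists_xor_isResidueArtinSchreier D.vGe_two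
  have hunit {d : F} (hd : VGe 0 d) : 1 + d * ν ≠ 0 :=
    (vEq_one.add_vGe (hd.mul hν.vGe) (by omega)).ne_zero
  refine Subgroup.index_eq_two_iff.mpr ⟨Units.mk0 _ (hunit hd₀), fun u => ?_⟩
  obtain ⟨y, hy, hu⟩ := D.exists_norm_div_sub_one t ht le_rfl u.ne_zero
  set N : Fˣ := Units.map (Algebra.norm F : K →* F) (Units.mk0 y hy) with hN
  have hNmem : N ∈ normGroup F K := ⟨_, rfl⟩
  have hd := hu.div hν
  rw [sub_self] at hd
  set d := (↑u / Algebra.norm F y - 1) / ν with hddef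
  have hud : u = N * Units.mk0 _ (hunit hd) := by
    ext
    have h1 : Algebra.norm F y ≠ 0 := Algebra.norm_ne_zero_iff.mpr hy
    have h2 := hν.ne_zero
    simp only [hN, hddef, Units.val_mul, Units.coe_map, Units.val_mk0]
    field_simp
    ring
  have hd' : VGe 0 (d + d₀ + d * d₀ * ν) :=
    (hd.add hd₀).add (((hd.mul hd₀).mul hν.vGe).mono (by omega))
  rw [hud, mul_assoc, Subgroup.mul_mem_cancel_left _ hNmem, Subgroup.mul_mem_cancel_left _ hNmem,
    key (Units.mk0 _ (hunit hd)) d hd rfl, key _ (d + d₀ + d * d₀ * ν) hd' (by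
      simp only [Units.val_mul, Units.val_mk0]
      ring)]
  refine hxor _ _ hd ?_
  rw [add_sub_cancel_left]
  exact ((hd.mul hd₀).mul hν.vGe).mono (by omega)

lemma mem_normGroup_of_mem_unitFiltration {n : ℕ} (hn : t < n) {u : Fˣ}
    (hu : u ∈ unitFiltration F n) : u ∈ normGroup F K := by
  obtain ⟨ν, hν, key⟩ := D.exists_norm_theta
  have hd := (mem_unitFiltration_iff.mp hu).2.div hν
  have hd1 := hd.mono (show 1 ≤ (n : ℤ) - t by omega)
  refine (key u _ (hd1.mono zero_le_one) ?_).mpr ⟨0, vGe_zero 0, by simpa using hd1.neg⟩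
  have := hν.ne_zero
  field_simp
  ring

lemma exists_mem_unitFiltration_notMem_normGroup {n : ℕ} (hn : n ≤ t) :
    ∃ u ∈ unitFiltration F n, u ∉ normGroup F K := by
  have ht := D.break_pos
  obtain ⟨ν, hν, key⟩ := D.exists_norm_theta
  obtain ⟨d₀, hd₀, hxor⟩ := exists_xor_isResidueArtinSchreier D.vGe_two
  have hdν : VGe (t : ℤ) (d₀ * ν) := by simpa using hd₀.mul hν.vGe
  refine ⟨Units.mk0 (1 + d₀ * ν) (vEq_one.add_vGe hdν (by omega)).ne_zero,
    unitFiltration_antitone hn (mem_unitFiltration_of_pos ht ?_), ?_⟩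
  · rwa [Units.val_mk0, add_sub_cancel_left]
  · rw [key _ d₀ hd₀ rfl]
    -- `0 = 0² - 0` is a value, so its translate `d₀` is not.
    have h0 : IsResidueArtinSchreier (0 : F) := ⟨0, vGe_zero 0, by simpa using vGe_zero 1⟩
    rcases hxor 0 d₀ (vGe_zero 0) (by simpa using vGe_zero 1) with h | h
    · exact (h.2 h0).elim
    · exact h.2

end IsWildDatum
end Norm

/-! ### Conductors -/

section Conductor

variable {L : Type*} [Field L] [ValuativeRel L] [TopologicalSpace L] [IsNonarchimedeanLocalField L]

lemma conductor_le {χ : Lˣ →* ℂˣ} {n : ℕ} (h : ∀ u ∈ unitFiltration L n, χ u = 1) :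
    conductor χ ≤ n :=
  Nat.sInf_le h

/-- A complex number all of whose iterated squares stay within `1 / 2` of `1` equals `1`. -/
lemma eq_one_of_norm_pow_sub_one_lt {z : ℂ} (h : ∀ k : ℕ, ‖z ^ 2 ^ k - 1‖ < 1 / 2) : z = 1 := by
  -- Squaring expands distances to `1` by a factor of at least `3 / 2` on this disc.
  have hgrow (k : ℕ) : (3 / 2 : ℝ) ^ k * ‖z - 1‖ ≤ ‖z ^ 2 ^ k - 1‖ := by
    induction k with
    | zero => simp
    | succ k ih =>
      set w := z ^ 2 ^ k with hw
      have e : z ^ 2 ^ (k + 1) - 1 = (w + 1) * (w - 1) := by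
        rw [hw, pow_succ, pow_mul]
        ring
      have h1 : 3 / 2 ≤ ‖w + 1‖ := by
        have h2 := norm_sub_norm_le (2 : ℂ) (1 - w)
        rw [norm_sub_rev, show (2 : ℂ) - (1 - w) = w + 1 by ring, Complex.norm_two] at h2
        have := h k
        linarith [norm_sub_rev (1 : ℂ) w]
      rw [e, norm_mul, pow_succ', mul_assoc]
      exact mul_le_mul h1 ih (by positivity) (norm_nonneg _)
  by_contra hz
  have hpos : 0 < ‖z - 1‖ := norm_pos_iff.mpr (sub_ne_zero.mpr hz)
  obtain ⟨k, hk⟩ := pow_unbounded_of_one_lt (1 / 2 / ‖z - 1‖) (show (1 : ℝ) < 3 / 2 by norm_num)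
  rw [div_lt_iff₀ hpos] at hk
  linarith [hgrow k, h k]

/-- A continuous character is trivial on some `U_L^n`, as `ℂˣ` has no small subgroups. -/
lemma exists_eq_one_on_unitFiltration {χ : Lˣ →* ℂˣ} (hχ : Continuous χ) :
    ∃ n : ℕ, ∀ u ∈ unitFiltration L n, χ u = 1 := by
  have hopen : IsOpen {z : ℂˣ | ‖(z : ℂ) - 1‖ < 1 / 2} :=
    isOpen_lt (by fun_prop) continuous_const
  have hmem := hχ.continuousAt.preimage_mem_nhds
    (hopen.mem_nhds (show χ 1 ∈ {z : ℂˣ | ‖(z : ℂ) - 1‖ < 1 / 2} by simp))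
  rw [Units.isEmbedding_val₀.nhds_eq_comap, Filter.mem_comap] at hmem
  obtain ⟨s, hs, hsub⟩ := hmem
  obtain ⟨γ, hγ⟩ := IsValuativeTopology.mem_nhds_iff'.mp hs
  obtain ⟨x, hx⟩ := valuation_surjective (γ : ValueGroupWithZero L)
  have hx0 : x ≠ 0 := by
    rintro rfl
    rw [map_zero] at hx
    exact γ.ne_zero hx.symm
  obtain ⟨i, hi⟩ := exists_vEq_of_ne_zero hx0
  refine ⟨i.toNat + 1, fun u hu => Units.ext (eq_one_of_norm_pow_sub_one_lt fun k => ?_)⟩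
  have hpow : VGe ((i.toNat + 1 : ℕ) : ℤ) (((u ^ 2 ^ k : Lˣ) : L) - 1) := by
    induction k with
    | zero => simpa using (mem_unitFiltration_iff.mp hu).2
    | succ k ih =>
      have h1 := vEq_zero_of_sub_one (ih.mono (by omega))
      rw [pow_succ, pow_mul, sq, Units.val_mul]
      set y : L := ((u ^ 2 ^ k : Lˣ) : L)
      rw [show y * y - 1 = (y + 1) * (y - 1) by ring]
      simpa using (h1.vGe.add vEq_one.vGe).mul ih
  have hs' : ((u ^ 2 ^ k : Lˣ) : L) ∈ s := by
    refine hγ ?_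
    rw [Set.mem_ofPred_eq, ← hx, lt_iff_not_ge, ← normVal_le_iff]
    intro hle
    have := hle.trans hpow
    rw [← VGe, hi.vGe_iff] at this
    omega
  have := hsub (show u ^ 2 ^ k ∈ Units.val ⁻¹' s from hs')
  rw [Set.mem_preimage, map_pow] at this
  simpa using this

lemma eq_one_of_mem_unitFiltration_conductor {χ : Lˣ →* ℂˣ}
    (h : ∃ n : ℕ, ∀ u ∈ unitFiltration L n, χ u = 1) {u : Lˣ}
    (hu : u ∈ unitFiltration L (conductor χ)) : χ u = 1 :=
  Nat.sInf_mem (s := {n : ℕ | ∀ u ∈ unitFiltration L n, χ u = 1}) h u hu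

end Conductor

lemma quadraticCharacter_eq_one_iff {F K : Type*} [Field F] [Field K] [Algebra F K]
    (h : (normGroup F K).index = 2) (u : Fˣ) :
    quadraticCharacter F K u = 1 ↔ u ∈ normGroup F K := by
  have hne : (-1 : ℂˣ) ≠ 1 := fun e => by
    have e' : (-1 : ℂ) = 1 := by simpa using congrArg Units.val e
    norm_num at e'
  by_cases hu : u ∈ normGroup F K <;> simp [quadraticCharacter, h, hu, hne]

namespace IsWildDatum

variable {F K : Type*}
  [Field F] [ValuativeRel F] [TopologicalSpace F] [IsNonarchimedeanLocalField F]
  [Field K] [ValuativeRel K] [TopologicalSpace K] [IsNonarchimedeanLocalField K]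
  [Algebra F K] {σ : K ≃ₐ[F] K} {π : K} {t : ℕ} (D : IsWildDatum F σ π t)
include D

/-- `U_F^n ⊆ U_K^{2n}`, as `v_K = 2 v_F` on `F`. -/
lemma map_mem_unitFiltration {n : ℕ} {u : Fˣ} (hu : u ∈ unitFiltration F n) :
    Units.map (algebraMap F K : F →* K) u ∈ unitFiltration K (2 * n) := by
  rw [mem_unitFiltration_iff] at hu ⊢
  refine ⟨by simpa using D.vEq_map hu.1, ?_⟩
  simpa using D.vGe_map_iff.mpr hu.2

variable [Algebra.IsQuadraticExtension F K]

/-- `U_K^{2n} = U_F^n U_K^{2n+1}` for `n ≥ 1`, as the residue fields agree. -/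
lemma exists_mul_mem_unitFiltration {n : ℕ} (hn : 0 < n) {z : Kˣ}
    (hz : z ∈ unitFiltration K (2 * n)) :
    ∃ u ∈ unitFiltration F n, ∃ w ∈ unitFiltration K (2 * n + 1),
      z = Units.map (algebraMap F K : F →* K) u * w := by
  obtain ⟨a, b, hab, ha, hb⟩ := D.exists_eq_add_mul (mem_unitFiltration_iff.mp hz).2
  have ha' : VGe (n : ℤ) a := D.vGe_of_map ha (by omega)
  have hb' : VGe (n : ℤ) b := D.vGe_of_map hb (by omega)
  have hu0 : VEq 0 (1 + a) := vEq_one.add_vGe ha' (by omega)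
  have hu : Units.mk0 _ hu0.ne_zero ∈ unitFiltration F n :=
    mem_unitFiltration_of_pos hn (by simpa using ha')
  refine ⟨_, hu, (Units.map (algebraMap F K : F →* K) (Units.mk0 _ hu0.ne_zero))⁻¹ * z,
    mem_unitFiltration_of_pos (by omega) ?_, (mul_inv_cancel_left _ _).symm⟩
  have huK : VEq 0 (algebraMap F K (1 + a)) := by simpa using D.vEq_map hu0
  have e : (((Units.map (algebraMap F K : F →* K) (Units.mk0 _ hu0.ne_zero))⁻¹ * z : Kˣ) : K) - 1
      = algebraMap F K b * π / algebraMap F K (1 + a) := by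
    have := huK.ne_zero
    simp only [Units.val_mul, Units.val_inv_eq_inv_val, Units.coe_map, Units.val_mk0,
      MonoidHom.coe_coe]
    field_simp
    rw [map_add, map_one]
    linear_combination hab
  rw [e]
  simpa using ((D.vGe_map_iff.mpr hb').mul D.vEq_unif.vGe).div huK

variable [IsGalois F K]

lemma quadraticCharacter_eq_one_on_unitFiltration_iff {n : ℕ} :
    (∀ u ∈ unitFiltration F n, quadraticCharacter F K u = 1) ↔ t < n := by
  simp only [quadraticCharacter_eq_one_iff D.index_normGroup]
  refine ⟨fun h => ?_, fun h u hu => D.mem_normGroup_of_mem_unitFiltration h hu⟩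
  by_contra! hn
  obtain ⟨u, hu, hu'⟩ := D.exists_mem_unitFiltration_notMem_normGroup hn
  exact hu' (h u hu)

lemma conductor_quadraticCharacter : conductor (quadraticCharacter F K) = t + 1 := by
  refine le_antisymm
    (conductor_le (D.quadraticCharacter_eq_one_on_unitFiltration_iff.mpr t.lt_succ_self)) ?_
  exact D.quadraticCharacter_eq_one_on_unitFiltration_iff.mp fun u hu =>
    eq_one_of_mem_unitFiltration_conductor
      ⟨t + 1, D.quadraticCharacter_eq_one_on_unitFiltration_iff.mpr t.lt_succ_self⟩ hu

/-- If a character of symplectic type has conductor at most `2 n`, then `n > t`. -/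
lemma lt_of_conductor_le {χ : Kˣ →* ℂˣ} (hχ : Continuous χ) (hs : IsSymplecticType F K χ) {n : ℕ}
    (h : conductor χ ≤ 2 * n) : t < n := by
  refine D.quadraticCharacter_eq_one_on_unitFiltration_iff.mp fun u hu => ?_
  rw [← hs]
  exact eq_one_of_mem_unitFiltration_conductor (exists_eq_one_on_unitFiltration hχ)
    (unitFiltration_antitone h (D.map_mem_unitFiltration hu))

/-- If `n > t`, then `χ` is trivial on `U_F^n`, so by `U_K^{2n} = U_F^n U_K^{2n+1}` it is trivial on
`U_K^{2n}` as soon as it is trivial on `U_K^{2n+1}`. -/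
lemma conductor_ne_of_lt {χ : Kˣ →* ℂˣ} (hχ : Continuous χ) (hs : IsSymplecticType F K χ) {n : ℕ}
    (hn : t < n) : conductor χ ≠ 2 * n + 1 := by
  intro h
  suffices conductor χ ≤ 2 * n by omega
  refine conductor_le fun z hz => ?_
  obtain ⟨u, hu, w, hw, rfl⟩ := D.exists_mul_mem_unitFiltration (by omega) hz
  have h1 : χ (Units.map (algebraMap F K : F →* K) u) = 1 := by
    have := D.quadraticCharacter_eq_one_on_unitFiltration_iff.mpr hn u hu
    rwa [← hs] at this
  rw [map_mul, h1, one_mul]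
  exact eq_one_of_mem_unitFiltration_conductor (exists_eq_one_on_unitFiltration hχ) (h ▸ hw)

end IsWildDatum

end WildQuadratic

theorem theorem1p1 {F K : Type*}
    [Field F] [ValuativeRel F] [TopologicalSpace F] [IsNonarchimedeanLocalField F] [CharZero F]
    [Field K] [ValuativeRel K] [TopologicalSpace K] [IsNonarchimedeanLocalField K]
    [Algebra F K] [ValuativeExtension F K] [Algebra.IsQuadraticExtension F K]
    (hwild : WildQuadratic.IsWildlyRamified F K)
    (t : ℤ) (ht : WildQuadratic.IsRamificationBreak F K t) :
    (WildQuadratic.conductor (WildQuadratic.quadraticCharacter F K) : ℤ) = t + 1 ∧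
    ∀ χ : Kˣ →* ℂˣ, Continuous χ → WildQuadratic.IsSymplecticType F K χ →
      (Odd (WildQuadratic.conductor χ) → (WildQuadratic.conductor χ : ℤ) = 2 * t + 1) ∧
      (Even (WildQuadratic.conductor χ) → 2 * (t + 1) ≤ (WildQuadratic.conductor χ : ℤ)) := by
  obtain ⟨σ, π, n, rfl, D⟩ := WildQuadratic.exists_isWildDatum hwild ht
  refine ⟨by exact_mod_cast D.conductor_quadraticCharacter, fun χ hχ hs => ⟨?_, ?_⟩⟩
  · rintro ⟨k, hk⟩
    have h1 := D.lt_of_conductor_le hχ hs (n := k + 1) (by omega)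
    have h2 : ¬ n < k := fun h => D.conductor_ne_of_lt hχ hs h hk
    omega
  · rintro ⟨k, hk⟩
    have h1 := D.lt_of_conductor_le hχ hs (n := k) (by omega)
    omega
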